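/- Let $q_{\mathrm{as}}(1)=\mathbb R[\xi]/(\xi^2-1)$ with $\xi$ odd, and let $Q(1)$ be the supergroup of its invertible elements: for a supercommutative $\mathbb R$-algebra $\Lambda=\Lambda_0\oplus\Lambda_1$, $Q(1)(\Lambda)$ is the group of invertible elements $x+\xi y$ with $x\in\Lambda_0$, $y\in\Lambda_1$, with product $$(x+\xi y)(x'+\xi y')=(xx'+\varepsilon\,yy')+\xi\,(xy'+yx'),$$ where $\varepsilon=-1$ if $\xi$ anticommutes with odd elements of $\Lambda$ (Koszul rule) and $\varepsilon=+1$ if $\xi$ commutes with them; the statement holds for both conventions. Put $\operatorname{otr}(x+\xi y)=y$ and $\operatorname{odet}(x+\xi y)=\sum_{j\ge1\text{ odd}}(x^{-1}y)^j/j\;(=x^{-1}y)$. For $N\ge 0$ let $$\mathcal O(Q(1)^N)=\mathbb R[a_1^{\pm1},\dots,a_N^{\pm1}]\otimes\textstyle\bigwedge(da_1,\dots,da_N)$$ be the algebra of algebraic functions on $Q(1)^N$, where $a_i$ and $da_i$ are the even and odd coordinates, i.e. the $i$-th matrix is $A_i=a_i+\xi\,da_i$. A function $f\in\mathcal O(Q(1)^N)$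 is invariant under conjugation if $f(gB_1g^{-1},\dots,gB_Ng^{-1})=f(B_1,\dots,B_N)$ for every supercommutative $\mathbb R$-algebra $\Lambda$, every $g\in Q(1)(\Lambda)$ and all $B_1,\dots,B_N\in Q(1)(\Lambda)$. **Proposition.** The set of conjugation-invariant functions in $\mathcal O(Q(1)^N)$ is equal to the $\mathbb R$-subalgebra generated by the odd traces $\operatorname{otr}(w(A_1,\dots,A_N))$ of all products $w$ of the matrices $A_1,\dots,A_N$ and their inverses, together with the odd determinants $\operatorname{odet}(A_1),\dots,\operatorname{odet}(A_N)$. -/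

import Mathlib

open scoped TensorProduct

noncomputable section

namespace QueerOne

/-- Expressions `x + ξ y` with `x, y` in a ring `Λ`, as pairs `(re, im) = (x, y)`.

For a supercommutative algebra `Λ`, the even part of `Λ ⊗ q_as(1)`, where
`q_as(1) = ℝ[ξ]/(ξ² - 1)` and `ξ` is odd, consists of the `x + ξ y` with `x` even and `y` odd
(see `evenPart`). The sign `ε` records the convention for moving `ξ` past odd elements of `Λ`,
that is, `ξ y ξ y' = ε y y'` for odd `y, y'`: the Koszul rule `y ξ = - ξ y` gives `ε = -1`, and
`y ξ = ξ y` gives `ε = 1`. -/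
@[ext]
structure QMat (ε : ℤˣ) (Λ : Type*) where
  /-- the part without `ξ` -/
  re : Λ
  /-- the coefficient of `ξ` -/
  im : Λ

namespace QMat

variable {ε : ℤˣ} {Λ : Type*} [Ring Λ]

instance : Zero (QMat ε Λ) := ⟨⟨0, 0⟩⟩
instance : One (QMat ε Λ) := ⟨⟨1, 0⟩⟩
instance : Add (QMat ε Λ) := ⟨fun A B => ⟨A.re + B.re, A.im + B.im⟩⟩
instance : Neg (QMat ε Λ) := ⟨fun A => ⟨-A.re, -A.im⟩⟩
/-- `(x + ξ y)(x' + ξ y') = (x x' + ε y y') + ξ (x y' + y x')`. -/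
instance : Mul (QMat ε Λ) :=
  ⟨fun A B => ⟨A.re * B.re + ((ε : ℤ) : Λ) * (A.im * B.im), A.re * B.im + A.im * B.re⟩⟩

@[simp] theorem re_zero : (0 : QMat ε Λ).re = 0 := rfl
@[simp] theorem im_zero : (0 : QMat ε Λ).im = 0 := rfl
@[simp] theorem re_one : (1 : QMat ε Λ).re = 1 := rfl
@[simp] theorem im_one : (1 : QMat ε Λ).im = 0 := rfl
@[simp] theorem re_add (A B : QMat ε Λ) : (A + B).re = A.re + B.re := rfl
@[simp] theorem im_add (A B : QMat ε Λ) : (A + B).im = A.im + B.im := rfl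
@[simp] theorem re_neg (A : QMat ε Λ) : (-A).re = -A.re := rfl
@[simp] theorem im_neg (A : QMat ε Λ) : (-A).im = -A.im := rfl
@[simp] theorem re_mul (A B : QMat ε Λ) :
    (A * B).re = A.re * B.re + ((ε : ℤ) : Λ) * (A.im * B.im) := rfl
@[simp] theorem im_mul (A B : QMat ε Λ) : (A * B).im = A.re * B.im + A.im * B.re := rfl

instance : Ring (QMat ε Λ) where
  add_assoc A B C := by ext <;> simp [add_assoc]
  zero_add A := by ext <;> simp
  add_zero A := by ext <;> simp
  add_comm A B := by ext <;> simp [add_comm]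
  neg_add_cancel A := by ext <;> simp
  nsmul := nsmulRec
  zsmul := zsmulRec
  left_distrib A B C := by ext <;> simp only [re_mul, im_mul, re_add, im_add] <;> noncomm_ring
  right_distrib A B C := by ext <;> simp only [re_mul, im_mul, re_add, im_add] <;> noncomm_ring
  zero_mul A := by ext <;> simp
  mul_zero A := by ext <;> simp
  one_mul A := by ext <;> simp
  mul_one A := by ext <;> simp
  mul_assoc A B C := by
    obtain rfl | rfl := Int.units_eq_one_or ε <;> ext <;>
      simp only [re_mul, im_mul, Units.val_one, Units.val_neg, Int.cast_one, Int.cast_neg] <;>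
      noncomm_ring

/-- The odd trace `otr (x + ξ y) = Tr y` (the trace of a `1 × 1` matrix is its entry). -/
def otr (A : QMat ε Λ) : Λ := A.im

/-- The odd determinant `odet (x + ξ y) = ∑_{j ≥ 1 odd} Tr ((x⁻¹ y) ^ j) / j`. For `x` an even unit
and `y` odd in a supercommutative algebra only the term `j = 1` is non-zero. -/
def odet [Algebra ℝ Λ] (A : QMat ε Λ) : Λ :=
  ∑ᶠ (j : ℕ) (_ : Odd j), ((j : ℝ)⁻¹) • (Ring.inverse A.re * A.im) ^ j

end QMat

/-! ### Supercommutative algebras and the supergroup `Q(1)` -/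

section Points

variable {Λ : Type*} [Ring Λ] [Algebra ℝ Λ]

/-- Supercommutativity of a `ℤ/2`-graded algebra: even elements are central and odd elements
anticommute. -/
structure IsSupercommutative (𝒜 : ZMod 2 → Submodule ℝ Λ) : Prop where
  even_comm : ∀ x ∈ 𝒜 0, ∀ y : Λ, x * y = y * x
  odd_anticomm : ∀ x ∈ 𝒜 1, ∀ y ∈ 𝒜 1, x * y = -(y * x)

theorem IsSupercommutative.odd_sq {𝒜 : ZMod 2 → Submodule ℝ Λ} (h : IsSupercommutative 𝒜)
    {x : Λ} (hx : x ∈ 𝒜 1) : x * x = 0 := by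
  have h1 : (2 : ℝ) • (x * x) = 0 := by
    rw [two_smul]
    exact eq_neg_iff_add_eq_zero.mp (h.odd_anticomm x hx x hx)
  simpa using h1

variable (ε : ℤˣ) (𝒜 : ZMod 2 → Submodule ℝ Λ) [GradedAlgebra 𝒜]

/-- The even part of `Λ ⊗ q_as(1)`: the elements `x + ξ y` with `x` even and `y` odd. -/
def evenPart : Subring (QMat ε Λ) where
  carrier := {A | A.re ∈ 𝒜 0 ∧ A.im ∈ 𝒜 1}
  zero_mem' := ⟨zero_mem _, zero_mem _⟩
  one_mem' := ⟨SetLike.GradedOne.one_mem, zero_mem _⟩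
  add_mem' hA hB := ⟨add_mem hA.1 hB.1, add_mem hA.2 hB.2⟩
  neg_mem' hA := ⟨neg_mem hA.1, neg_mem hA.2⟩
  mul_mem' {A B} hA hB := by
    have h1 : A.im * B.im ∈ 𝒜 0 := SetLike.mul_mem_graded (A := 𝒜) hA.2 hB.2
    refine ⟨add_mem (SetLike.mul_mem_graded (A := 𝒜) (i := 0) (j := 0) hA.1 hB.1) ?_,
      add_mem (SetLike.mul_mem_graded (A := 𝒜) (i := 0) (j := 1) hA.1 hB.2)
        (SetLike.mul_mem_graded (A := 𝒜) (i := 1) (j := 0) hA.2 hB.1)⟩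
    rw [← zsmul_eq_mul]
    exact zsmul_mem h1 _

/-- The group `Q(1)(Λ)` of `Λ`-points of the supergroup `Q(1)` of invertible elements of
`q_as(1)`. -/
abbrev Q1 : Type _ := (evenPart ε 𝒜)ˣ

variable {ε 𝒜}

theorem IsSupercommutative.re_mem_center (h : IsSupercommutative 𝒜) (A : evenPart ε 𝒜) :
    A.1.re ∈ Subalgebra.center ℝ Λ :=
  Subalgebra.mem_center_iff.mpr fun y => (h.even_comm _ A.2.1 y).symm

/-- The even coordinate `x` of an invertible `x + ξ y`, as a unit of the centre of `Λ`. -/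
def IsSupercommutative.reUnit (h : IsSupercommutative 𝒜) (A : Q1 ε 𝒜) :
    (Subalgebra.center ℝ Λ)ˣ := by
  have hc : ((ε : ℤ) : Λ) * (A.1.1.im * (A⁻¹).1.1.im) ∈ 𝒜 0 := by
    rw [← zsmul_eq_mul]
    exact zsmul_mem (SetLike.mul_mem_graded (A := 𝒜) (i := 1) (j := 1) A.1.2.2 (A⁻¹).1.2.2) _
  have e1 : A.1.1.re * (A⁻¹).1.1.re + ((ε : ℤ) : Λ) * (A.1.1.im * (A⁻¹).1.1.im) = 1 := by
    exact congrArg (fun B : evenPart ε 𝒜 => B.1.re) A.mul_inv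
  have hsq : (((ε : ℤ) : Λ) * (A.1.1.im * (A⁻¹).1.1.im)) *
      (((ε : ℤ) : Λ) * (A.1.1.im * (A⁻¹).1.1.im)) = 0 := by
    have h0 : (A.1.1.im * (A⁻¹).1.1.im) * (A.1.1.im * (A⁻¹).1.1.im) = 0 := by
      rw [h.odd_anticomm _ A.1.2.2 _ (A⁻¹).1.2.2, neg_mul_neg, mul_assoc,
        ← mul_assoc A.1.1.im, h.odd_anticomm _ A.1.2.2 _ (A⁻¹).1.2.2]
      rw [neg_mul, mul_assoc, h.odd_sq A.1.2.2]
      simp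
    rw [(Int.cast_commute (ε : ℤ) (A.1.1.im * (A⁻¹).1.1.im)).symm.mul_mul_mul_comm, h0, mul_zero]
  have e2 : A.1.1.re * ((A⁻¹).1.1.re * (1 + ((ε : ℤ) : Λ) * (A.1.1.im * (A⁻¹).1.1.im))) = 1 := by
    rw [← mul_assoc, eq_sub_of_add_eq e1, mul_add, mul_one, sub_mul, one_mul, hsq]
    abel
  exact Units.mkOfMulEqOne ⟨A.1.1.re, h.re_mem_center A.1⟩
    (⟨(A⁻¹).1.1.re, h.re_mem_center (A⁻¹).1⟩ *
      (1 + ⟨_, Subalgebra.mem_center_iff.mpr fun y => (h.even_comm _ hc y).symm⟩))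
    (Subtype.ext e2)

theorem IsSupercommutative.coe_reUnit (h : IsSupercommutative 𝒜) (A : Q1 ε 𝒜) :
    ((h.reUnit A : Subalgebra.center ℝ Λ) : Λ) = A.1.1.re := rfl

end Points

/-! ### Algebraic functions on `Q(1)^N` -/

section Functions

variable (N : ℕ)

/-- The algebra of algebraic functions on `Q(1)^N`: Laurent polynomials in the even coordinates
`a_1, …, a_N`, tensored with the exterior algebra on the odd coordinates `da_1, …, da_N`. -/
def Fun : Type :=
  AddMonoidAlgebra ℝ (Fin N → ℤ) ⊗[ℝ] ExteriorAlgebra ℝ (Fin N → ℝ)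

instance : Ring (Fun N) :=
  inferInstanceAs (Ring (AddMonoidAlgebra ℝ (Fin N → ℤ) ⊗[ℝ] ExteriorAlgebra ℝ (Fin N → ℝ)))

instance : Algebra ℝ (Fun N) :=
  inferInstanceAs (Algebra ℝ (AddMonoidAlgebra ℝ (Fin N → ℤ) ⊗[ℝ] ExteriorAlgebra ℝ (Fin N → ℝ)))

variable {N}

/-- The inclusion of the functions of the even coordinates. -/
def evenIncl : AddMonoidAlgebra ℝ (Fin N → ℤ) →ₐ[ℝ] Fun N :=
  Algebra.TensorProduct.includeLeft (R := ℝ) (S := ℝ) (A := AddMonoidAlgebra ℝ (Fin N → ℤ))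
    (B := ExteriorAlgebra ℝ (Fin N → ℝ))

/-- The inclusion of the functions of the odd coordinates. -/
def oddIncl : ExteriorAlgebra ℝ (Fin N → ℝ) →ₐ[ℝ] Fun N :=
  Algebra.TensorProduct.includeRight (R := ℝ) (A := AddMonoidAlgebra ℝ (Fin N → ℤ))
    (B := ExteriorAlgebra ℝ (Fin N → ℝ))

theorem evenIncl_commute (p : AddMonoidAlgebra ℝ (Fin N → ℤ))
    (w : ExteriorAlgebra ℝ (Fin N → ℝ)) : Commute (evenIncl p) (oddIncl w) :=
  (Commute.one_right p).tmul (Commute.one_left w)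

/-- The monomial `a^m`, for an integer exponent vector `m`. -/
def evenMonomial (m : Fin N → ℤ) : Fun N := evenIncl (AddMonoidAlgebra.single m 1)

/-- The odd coordinate `da_i`. -/
def oddCoord (i : Fin N) : Fun N := oddIncl (ExteriorAlgebra.ι ℝ (Pi.single i 1))

theorem evenMonomial_mul (m m' : Fin N → ℤ) :
    evenMonomial m * evenMonomial m' = evenMonomial (m + m') := by
  simp [evenMonomial, ← map_mul, AddMonoidAlgebra.single_mul_single]

theorem evenMonomial_zero : evenMonomial (0 : Fin N → ℤ) = 1 :=
  map_one evenIncl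

theorem oddCoord_mul_evenMonomial (m : Fin N → ℤ) (i : Fin N) :
    oddCoord i * evenMonomial m = evenMonomial m * oddCoord i :=
  (evenIncl_commute _ _).eq.symm

theorem oddCoord_sq (i : Fin N) : oddCoord i * oddCoord i = 0 := by
  simp [oddCoord, ← map_mul]

/-- The `i`-th matrix `A_i = a_i + ξ da_i` of the coordinates on `Q(1)^N`, with its inverse
`a_i⁻¹ - ξ a_i⁻² da_i`. -/
def coordMat (ε : ℤˣ) (i : Fin N) : (QMat ε (Fun N))ˣ where
  val := ⟨evenMonomial (Pi.single i 1), oddCoord i⟩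
  inv := ⟨evenMonomial (Pi.single i (-1)), -(evenMonomial (Pi.single i (-2)) * oddCoord i)⟩
  val_inv := by
    ext
    · simp [evenMonomial_mul, evenMonomial_zero, ← Pi.single_add, ← mul_assoc,
        oddCoord_mul_evenMonomial]
      simp [mul_assoc, oddCoord_sq]
    · simp [evenMonomial_mul, ← Pi.single_add, ← mul_assoc, oddCoord_mul_evenMonomial]
  inv_val := by
    ext
    · simp [evenMonomial_mul, evenMonomial_zero, ← Pi.single_add, mul_assoc, oddCoord_sq]
    · simp [mul_assoc, oddCoord_mul_evenMonomial]
      simp [← mul_assoc, evenMonomial_mul, ← Pi.single_add]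

/-- Evaluation of functions on `Q(1)^N` at a `Λ`-point `(x_i + ξ y_i)_i`: the algebra map with
`a_i ↦ x_i` and `da_i ↦ y_i`. -/
def evalAt {Λ : Type*} [Ring Λ] [Algebra ℝ Λ] {ε : ℤˣ} {𝒜 : ZMod 2 → Submodule ℝ Λ}
    [GradedAlgebra 𝒜] (h : IsSupercommutative 𝒜) (A : Fin N → Q1 ε 𝒜) : Fun N →ₐ[ℝ] Λ :=
  Algebra.TensorProduct.lift (R := ℝ) (S := ℝ) (A := AddMonoidAlgebra ℝ (Fin N → ℤ))
    (B := ExteriorAlgebra ℝ (Fin N → ℝ))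
    ((Subalgebra.center ℝ Λ).val.comp
      (AddMonoidAlgebra.lift ℝ (Subalgebra.center ℝ Λ) (Fin N → ℤ)
        { toFun := fun m => ((∏ i, h.reUnit (A i) ^ (Multiplicative.toAdd m i) :
            (Subalgebra.center ℝ Λ)ˣ) : Subalgebra.center ℝ Λ)
          map_one' := by simp
          map_mul' := fun m m' => by
            simp [zpow_add, Finset.prod_mul_distrib] }))
    (ExteriorAlgebra.lift ℝ ⟨Fintype.linearCombination ℝ (fun i => (A i).1.1.im), fun v => by
      refine h.odd_sq ?_
      rw [Fintype.linearCombination_apply]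
      exact sum_mem fun i _ => (𝒜 1).smul_mem _ (A i).1.2.2⟩)
    (fun x y => (Subalgebra.mem_center_iff.mp (Subtype.prop _) _).symm)

/-- Invariance of a function on `Q(1)^N` under simultaneous conjugation by the supergroup `Q(1)`,
in the functor-of-points language: `f(g A_1 g⁻¹, …, g A_N g⁻¹) = f(A_1, …, A_N)` for all points `A`
of `Q(1)^N` and `g` of `Q(1)` with values in any supercommutative algebra. -/
def IsConjInvariant (ε : ℤˣ) (f : Fun N) : Prop :=
  ∀ (Λ : Type) [Ring Λ] [Algebra ℝ Λ] (𝒜 : ZMod 2 → Submodule ℝ Λ) [GradedAlgebra 𝒜]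
    (h : IsSupercommutative 𝒜) (g : Q1 ε 𝒜) (A : Fin N → Q1 ε 𝒜),
    evalAt h (fun i => g * A i * g⁻¹) f = evalAt h A f

variable (N)

/-- The odd traces of all products of the matrices `A_1, …, A_N` and their inverses. -/
def oddTraces (ε : ℤˣ) : Set (Fun N) :=
  Set.range fun w : FreeGroup (Fin N) =>
    QMat.otr (FreeGroup.lift (coordMat ε) w : (QMat ε (Fun N))ˣ).val

/-- The odd determinants of the `N` matrices `A_1, …, A_N`. -/
def oddDets (ε : ℤˣ) : Set (Fun N) :=
  Set.range fun i : Fin N => QMat.odet (coordMat ε i).val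

end Functions

end QueerOne

end

/-! Write `η` for an odd parameter. Conjugation by `1 + ξ η` fixes every odd coordinate `da_i` and
every `dlog a_i = a_i⁻¹ da_i`, and multiplies `a^m` by `1 + 2 ε η dlog(a^m)`. Every function is a
sum of terms `a^m ω_m` with `ω_m` a constant-coefficient form in the `dlog a_i`
(`laurentSum_surjective`), so invariance forces `dlog(a^m) ω_m = 0` for each `m`
(`ι_realVec_mul_eq_zero_of_isConjInvariant`): the invariants are the closed forms on the torus. For
`m ≠ 0`, Koszul exactness (`exists_eq_ι_mul`) gives `ω_m = dlog(a^m) ω'`, hence `a^m ω_m = d(a^m)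
ω'`. The forms `dlog a_i` are the odd determinants. The forms `d(a^m)` come from the odd traces
because the matrices `a^m + ξ d(a^m)` multiply like monomials under the symmetrised product
(`monomialMat_jordan`). Conversely, odd traces are invariant because conjugation fixes the odd
coordinate (`im_conj`), and odd determinants because it also fixes the product of the two
coordinates (`re_conj_mul_im`). -/

noncomputable section

namespace QueerOne

/-! ### Functoriality of the matrices and truncation of the odd determinant. -/

namespace QMat

variable {ε : ℤˣ} {Λ Λ' : Type*} [Ring Λ] [Ring Λ']

/-- The ring homomorphism `x + ξ y ↦ φ x + ξ φ y`. -/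
def map (φ : Λ →+* Λ') : QMat ε Λ →+* QMat ε Λ' where
  toFun A := ⟨φ A.re, φ A.im⟩
  map_one' := by ext <;> simp
  map_mul' A B := by ext <;> simp
  map_zero' := by ext <;> simp
  map_add' A B := by ext <;> simp

@[simp] theorem re_map (φ : Λ →+* Λ') (A : QMat ε Λ) : (map φ A).re = φ A.re := rfl
@[simp] theorem im_map (φ : Λ →+* Λ') (A : QMat ε Λ) : (map φ A).im = φ A.im := rfl

/-- An odd exponent other than 1 is at least 3, so its term contains the vanishing square. -/
theorem odet_eq_of_mul_self_eq_zero [Algebra ℝ Λ] (A : QMat ε Λ)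
    (hA : (Ring.inverse A.re * A.im) * (Ring.inverse A.re * A.im) = 0) :
    odet A = Ring.inverse A.re * A.im := by
  rw [odet, finsum_eq_single _ 1]
  · simp
  · intro j hj
    by_cases ho : Odd j
    swap
    · simp [ho]
    obtain ⟨k, rfl⟩ : ∃ k, j = k + 2 := by
      obtain ⟨k, rfl⟩ := ho
      -- The natural subtraction is genuine: `hj` excludes `k = 0`.
      exact ⟨2 * k - 1, by omega⟩
    simp [pow_add, pow_two, hA]

end QMat

/-! ### Effect of conjugation on the two coordinates. -/

section Conjugation

variable {Λ : Type*} [Ring Λ] [Algebra ℝ Λ] {ε : ℤˣ} {𝒜 : ZMod 2 → Submodule ℝ Λ}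

theorem IsSupercommutative.mul_mul_self_of_odd (h : IsSupercommutative 𝒜) {x y : Λ}
    (hx : x ∈ 𝒜 1) (hy : y ∈ 𝒜 1) : x * (y * x) = 0 := by
  rw [h.odd_anticomm y hy x hx, mul_neg, ← mul_assoc, h.odd_sq hx, zero_mul, neg_zero]

variable [GradedAlgebra 𝒜]

theorem mul_mem_even_of_odd {x y : Λ} (hx : x ∈ 𝒜 1) (hy : y ∈ 𝒜 1) : x * y ∈ 𝒜 0 :=
  SetLike.mul_mem_graded (A := 𝒜) hx hy

theorem Q1.mul_inv_re (g : Q1 ε 𝒜) :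
    g.1.1.re * (g⁻¹).1.1.re + ((ε : ℤ) : Λ) * (g.1.1.im * (g⁻¹).1.1.im) = 1 :=
  congrArg (fun B : evenPart ε 𝒜 => B.1.re) g.mul_inv

theorem Q1.mul_inv_im (g : Q1 ε 𝒜) :
    g.1.1.re * (g⁻¹).1.1.im + g.1.1.im * (g⁻¹).1.1.re = 0 :=
  congrArg (fun B : evenPart ε 𝒜 => B.1.im) g.mul_inv

/-- The even parts of `g g⁻¹ = 1` and `g⁻¹ g = 1` differ only in the sign of this product, so twice
it vanishes. -/
theorem IsSupercommutative.im_mul_im_inv (h : IsSupercommutative 𝒜) (g : Q1 ε 𝒜) :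
    g.1.1.im * (g⁻¹).1.1.im = 0 := by
  have h1 := Q1.mul_inv_re g
  have h2 := Q1.mul_inv_re g⁻¹
  rw [inv_inv, h.even_comm _ (g⁻¹).1.2.1, h.odd_anticomm _ (g⁻¹).1.2.2 _ g.1.2.2, mul_neg] at h2
  have h3 : (2 : ℝ) • (((ε : ℤ) : Λ) * (g.1.1.im * (g⁻¹).1.1.im)) = 0 := by
    have h5 := sub_eq_zero.mpr (h1.trans h2.symm)
    rw [add_sub_add_left_eq_sub, sub_neg_eq_add] at h5
    rwa [two_smul]
  have h4 : ((ε : ℤ) : Λ) * (g.1.1.im * (g⁻¹).1.1.im) = 0 := by simpa using h3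
  obtain rfl | rfl := Int.units_eq_one_or ε <;> simpa using h4

theorem IsSupercommutative.re_mul_re_inv (h : IsSupercommutative 𝒜) (g : Q1 ε 𝒜) :
    g.1.1.re * (g⁻¹).1.1.re = 1 := by
  simpa [h.im_mul_im_inv g] using Q1.mul_inv_re g

/-- Conjugation does not change the odd coordinate. -/
theorem IsSupercommutative.im_conj (h : IsSupercommutative 𝒜) (g A : Q1 ε 𝒜) :
    (g * A * g⁻¹).1.1.im = A.1.1.im := by
  have e1 := h.re_mul_re_inv g
  have e2 := Q1.mul_inv_im g
  have e3 : g.1.1.im * (A.1.1.im * (g⁻¹).1.1.im) = 0 := by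
    rw [h.odd_anticomm _ A.1.2.2 _ (g⁻¹).1.2.2, mul_neg, ← mul_assoc, h.im_mul_im_inv, zero_mul,
      neg_zero]
  have hx := h.even_comm _ A.1.2.1
  have hv := h.even_comm _ (g⁻¹).1.2.1
  change (g.1.1.re * A.1.1.re + ((ε : ℤ) : Λ) * (g.1.1.im * A.1.1.im)) * (g⁻¹).1.1.im +
    (g.1.1.re * A.1.1.im + g.1.1.im * A.1.1.re) * (g⁻¹).1.1.re = A.1.1.im
  calc _ = A.1.1.re * (g.1.1.re * (g⁻¹).1.1.im + g.1.1.im * (g⁻¹).1.1.re)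
        + ((ε : ℤ) : Λ) * (g.1.1.im * (A.1.1.im * (g⁻¹).1.1.im))
        + g.1.1.re * (g⁻¹).1.1.re * A.1.1.im := by
          rw [← hx g.1.1.re, ← hx g.1.1.im, mul_assoc g.1.1.re (g⁻¹).1.1.re, hv A.1.1.im]
          noncomm_ring
    _ = _ := by rw [e1, e2, e3]; simp

/-- Conjugation does not change the product of the even and the odd coordinate. -/
theorem IsSupercommutative.re_conj_mul_im (h : IsSupercommutative 𝒜) (g A : Q1 ε 𝒜) :
    (g * A * g⁻¹).1.1.re * A.1.1.im = A.1.1.re * A.1.1.im := by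
  have e1 := h.re_mul_re_inv g
  have e2 := h.im_mul_im_inv g
  have hx := h.even_comm _ A.1.2.1
  have hv := h.even_comm _ (g⁻¹).1.2.1
  have e3 := h.odd_sq A.1.2.2
  have e4 := h.mul_mul_self_of_odd A.1.2.2 (g⁻¹).1.2.2
  change ((g.1.1.re * A.1.1.re + ((ε : ℤ) : Λ) * (g.1.1.im * A.1.1.im)) * (g⁻¹).1.1.re +
    ((ε : ℤ) : Λ) * ((g.1.1.re * A.1.1.im + g.1.1.im * A.1.1.re) * (g⁻¹).1.1.im)) * A.1.1.im =
      A.1.1.re * A.1.1.im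
  -- Conjugation changes the even coordinate by multiples of `A.im`, which a further factor `A.im`
  -- kills, and by a multiple of `g.im * g⁻¹.im = 0`.
  calc _ = A.1.1.re * (g.1.1.re * (g⁻¹).1.1.re) * A.1.1.im
        + ((ε : ℤ) : Λ) * (g.1.1.im * (A.1.1.im * A.1.1.im) * (g⁻¹).1.1.re)
        + ((ε : ℤ) : Λ) * (g.1.1.re * (A.1.1.im * ((g⁻¹).1.1.im * A.1.1.im)))
        + ((ε : ℤ) : Λ) * (A.1.1.re * (g.1.1.im * (g⁻¹).1.1.im) * A.1.1.im) := by
          rw [← hx g.1.1.re, ← hx g.1.1.im, mul_assoc g.1.1.im (A.1.1.im * A.1.1.im),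
            mul_assoc A.1.1.im A.1.1.im, ← hv A.1.1.im]
          noncomm_ring
    _ = _ := by rw [e1, e2, e3, e4]; simp

end Conjugation

/-! ### Evaluation at points, and invariance of the generators. -/

section Eval

variable {N : ℕ} {Λ : Type*} [Ring Λ] [Algebra ℝ Λ] {ε : ℤˣ} {𝒜 : ZMod 2 → Submodule ℝ Λ}
  [GradedAlgebra 𝒜]

theorem evalAt_evenMonomial (h : IsSupercommutative 𝒜) (A : Fin N → Q1 ε 𝒜) (m : Fin N → ℤ) :
    evalAt h A (evenMonomial m) =
      ((∏ i, h.reUnit (A i) ^ m i : (Subalgebra.center ℝ Λ)ˣ) : Subalgebra.center ℝ Λ) := by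
  simp only [evalAt, evenMonomial, evenIncl]
  erw [Algebra.TensorProduct.lift_tmul]
  simp [AddMonoidAlgebra.lift_single]

theorem evalAt_evenMonomial_single (h : IsSupercommutative 𝒜) (A : Fin N → Q1 ε 𝒜) (i : Fin N)
    (k : ℤ) : evalAt h A (evenMonomial (Pi.single i k)) =
      ((h.reUnit (A i) ^ k : (Subalgebra.center ℝ Λ)ˣ) : Subalgebra.center ℝ Λ) := by
  rw [evalAt_evenMonomial, Finset.prod_eq_single i]
  · simp
  · intro j _ hj
    simp [Pi.single_eq_of_ne hj]
  · simp

theorem evalAt_oddCoord (h : IsSupercommutative 𝒜) (A : Fin N → Q1 ε 𝒜) (i : Fin N) :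
    evalAt h A (oddCoord i) = (A i).1.1.im := by
  simp only [evalAt, oddCoord, oddIncl]
  erw [Algebra.TensorProduct.lift_tmul]
  simp

/-- The logarithmic differential `dlog a_i = a_i⁻¹ da_i`. -/
def logCoord (i : Fin N) : Fun N := evenMonomial (Pi.single i (-1)) * oddCoord i

theorem odet_coordMat (i : Fin N) : QMat.odet (coordMat ε i).val = logCoord i := by
  have h1 : Ring.inverse (evenMonomial (Pi.single i 1) : Fun N) =
      evenMonomial (Pi.single i (-1)) := by
    have h2 : ∀ k : ℤ,
        (evenMonomial (Pi.single i k) : Fun N) * evenMonomial (Pi.single i (-k)) = 1 := by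
      intro k
      rw [evenMonomial_mul, ← Pi.single_add]
      simp [evenMonomial_zero]
    exact Ring.inverse_unit ⟨_, _, h2 1, by simpa using h2 (-1)⟩
  have h3 : Ring.inverse (coordMat ε i).val.re * (coordMat ε i).val.im = logCoord i := by
    simp only [coordMat, h1, logCoord]
  rw [QMat.odet_eq_of_mul_self_eq_zero, h3]
  rw [h3, logCoord, mul_assoc, ← mul_assoc (oddCoord i), oddCoord_mul_evenMonomial,
    mul_assoc _ (oddCoord i), oddCoord_sq, mul_zero, mul_zero]

theorem evalAt_logCoord_conj (h : IsSupercommutative 𝒜) (g : Q1 ε 𝒜) (A : Fin N → Q1 ε 𝒜)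
    (i : Fin N) :
    evalAt h (fun i => g * A i * g⁻¹) (logCoord i) = evalAt h A (logCoord i) := by
  simp only [logCoord, map_mul, evalAt_oddCoord, evalAt_evenMonomial_single, h.im_conj]
  have key : ∀ (u : (Subalgebra.center ℝ Λ)ˣ) (y z : Λ), ((u : Subalgebra.center ℝ Λ) : Λ) * y = z →
      y = ((u⁻¹ : (Subalgebra.center ℝ Λ)ˣ) : Subalgebra.center ℝ Λ) * z := by
    rintro u y _ rfl
    rw [← mul_assoc, ← MulMemClass.coe_mul]
    simp
  rw [zpow_neg_one, zpow_neg_one]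
  -- With `x'` the conjugated even coordinate, clearing its inverse leaves `x' (x⁻¹ y) = y`, which
  -- follows from `x' y = x y`.
  refine (key _ _ _ ?_).symm
  rw [h.coe_reUnit, ← (h.even_comm _ (g * A i * g⁻¹).1.2.1 _).symm, mul_assoc,
    ← h.even_comm _ (g * A i * g⁻¹).1.2.1, h.re_conj_mul_im, ← h.coe_reUnit (A i), ← mul_assoc,
    ← MulMemClass.coe_mul]
  simp

/-- Evaluation at a point of `Q(1)^N` carries the word `w` in the coordinate matrices to the
word `w` in the matrices of the point. -/
theorem map_evalAt_lift_coordMat (h : IsSupercommutative 𝒜) (A : Fin N → Q1 ε 𝒜)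
    (w : FreeGroup (Fin N)) :
    QMat.map (evalAt h A : Fun N →+* Λ) (FreeGroup.lift (coordMat ε) w : (QMat ε (Fun N))ˣ).val =
      (FreeGroup.lift A w).1.1 := by
  have key : (Units.map (QMat.map (ε := ε) (evalAt h A : Fun N →+* Λ)).toMonoidHom).comp
      (FreeGroup.lift (coordMat ε)) =
      (Units.map (evenPart ε 𝒜).subtype.toMonoidHom).comp (FreeGroup.lift A) := by
    ext i
    · simp [coordMat, evalAt_evenMonomial_single, h.coe_reUnit]
    · simp [coordMat, evalAt_oddCoord]
  exact congrArg Units.val (DFunLike.congr_fun key w)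

/-- A word in conjugated matrices is the conjugate of the word, and conjugation preserves odd
coordinates. -/
theorem evalAt_oddTrace_conj (h : IsSupercommutative 𝒜) (g : Q1 ε 𝒜) (A : Fin N → Q1 ε 𝒜)
    (w : FreeGroup (Fin N)) :
    evalAt h (fun i => g * A i * g⁻¹)
        (QMat.otr (FreeGroup.lift (coordMat ε) w : (QMat ε (Fun N))ˣ).val) =
      evalAt h A (QMat.otr (FreeGroup.lift (coordMat ε) w : (QMat ε (Fun N))ˣ).val) := by
  have e : ∀ B : Fin N → Q1 ε 𝒜, evalAt h B
      (QMat.otr (FreeGroup.lift (coordMat ε) w : (QMat ε (Fun N))ˣ).val) =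
        (FreeGroup.lift B w).1.1.im :=
    fun B => congrArg QMat.im (map_evalAt_lift_coordMat h B w)
  have hconj : FreeGroup.lift (fun i => g * A i * g⁻¹) =
      (MulAut.conj g).toMonoidHom.comp (FreeGroup.lift A) := by
    ext i : 1
    simp
  rw [e, e, hconj]
  exact h.im_conj g _

theorem isConjInvariant_of_mem_adjoin {f : Fun N}
    (hf : f ∈ Algebra.adjoin ℝ (oddTraces N ε ∪ oddDets N ε)) : IsConjInvariant ε f := by
  intro Λ _ _ 𝒜 _ h g A
  have hle : Algebra.adjoin ℝ (oddTraces N ε ∪ oddDets N ε) ≤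
      AlgHom.equalizer (evalAt h (fun i => g * A i * g⁻¹)) (evalAt h A) := by
    refine Algebra.adjoin_le ?_
    rintro _ (⟨w, rfl⟩ | ⟨i, rfl⟩)
    · exact evalAt_oddTrace_conj h g A w
    · change evalAt _ _ (QMat.odet (coordMat ε i).val) = evalAt _ _ (QMat.odet (coordMat ε i).val)
      rw [odet_coordMat]
      exact evalAt_logCoord_conj h g A i
  exact hle hf

end Eval

/-! ### Expansion of functions in Laurent monomials and logarithmic forms. -/

section LogForms

variable {N : ℕ}

/-- Exchanging the two summation indices shows that the square equals its own negative. -/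
theorem linearCombination_mul_self {Λ : Type*} [Ring Λ] [Algebra ℝ Λ] (l : Fin N → Λ)
    (hl : ∀ i j, l i * l j = -(l j * l i)) (v : Fin N → ℝ) :
    Fintype.linearCombination ℝ l v * Fintype.linearCombination ℝ l v = 0 := by
  have h1 : (2 : ℝ) • (Fintype.linearCombination ℝ l v * Fintype.linearCombination ℝ l v) = 0 := by
    rw [two_smul, ← eq_neg_iff_add_eq_zero, Fintype.linearCombination_apply, Finset.sum_mul_sum]
    nth_rewrite 2 [Finset.sum_comm]
    simp only [← Finset.sum_neg_distrib]
    refine Finset.sum_congr rfl fun i _ => Finset.sum_congr rfl fun j _ => ?_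
    rw [smul_mul_smul_comm, smul_mul_smul_comm, hl i j, mul_comm (v i), smul_neg]
  simpa using h1

theorem oddCoord_mul_oddCoord (i j : Fin N) :
    oddCoord i * oddCoord j = -(oddCoord j * oddCoord i) := by
  rw [eq_neg_iff_add_eq_zero]
  simp only [oddCoord, ← map_mul, ← map_add, ExteriorAlgebra.ι_add_mul_swap, map_zero]

theorem logCoord_mul_logCoord (i j : Fin N) :
    logCoord i * logCoord j = -(logCoord j * logCoord i) := by
  have e : ∀ i j : Fin N, logCoord i * logCoord j =
      evenMonomial (Pi.single i (-1) + Pi.single j (-1)) * (oddCoord i * oddCoord j) := by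
    intro i j
    rw [logCoord, logCoord, mul_assoc, ← mul_assoc (oddCoord i), oddCoord_mul_evenMonomial,
      mul_assoc, ← mul_assoc, evenMonomial_mul]
  rw [e, e, oddCoord_mul_oddCoord, add_comm, mul_neg]

/-- The algebra of logarithmic forms with constant coefficients, as a map from the exterior
algebra sending the `i`-th basis vector to `dlog a_i`. -/
def logForm : ExteriorAlgebra ℝ (Fin N → ℝ) →ₐ[ℝ] Fun N :=
  ExteriorAlgebra.lift ℝ ⟨Fintype.linearCombination ℝ logCoord,
    linearCombination_mul_self _ logCoord_mul_logCoord⟩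

theorem logForm_ι (v : Fin N → ℝ) :
    logForm (ExteriorAlgebra.ι ℝ v) = Fintype.linearCombination ℝ logCoord v := by
  simp [logForm]

theorem logForm_ι_single (i : Fin N) (c : ℝ) :
    logForm (ExteriorAlgebra.ι ℝ (Pi.single i c)) = c • logCoord i := by
  rw [logForm_ι, Fintype.linearCombination_apply_single]

theorem commute_evenMonomial_logForm (m : Fin N → ℤ) (w : ExteriorAlgebra ℝ (Fin N → ℝ)) :
    Commute (evenMonomial m) (logForm w) := by
  have hc : ∀ i : Fin N, Commute (evenMonomial m) (logCoord i) := fun i =>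
    Commute.mul_right (by rw [commute_iff_eq, evenMonomial_mul, evenMonomial_mul, add_comm])
      (oddCoord_mul_evenMonomial m i).symm
  induction w using ExteriorAlgebra.induction with
  | algebraMap r => rw [AlgHom.commutes]; exact (Algebra.commutes r _).symm
  | ι v =>
    rw [logForm_ι, Fintype.linearCombination_apply]
    exact Commute.sum_right _ _ _ fun i _ => (hc i).smul_right _
  | mul a b ha hb => rw [map_mul]; exact ha.mul_right hb
  | add a b ha hb => rw [map_add]; exact ha.add_right hb

/-- The sum `∑ m, a^m ω_m` of a family of logarithmic forms with constant coefficients. -/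
def laurentSum : ((Fin N → ℤ) →₀ ExteriorAlgebra ℝ (Fin N → ℝ)) →ₗ[ℝ] Fun N :=
  Finsupp.lsum ℝ fun m => (LinearMap.mulLeft ℝ (evenMonomial m)) ∘ₗ logForm.toLinearMap

theorem laurentSum_apply (ω : (Fin N → ℤ) →₀ ExteriorAlgebra ℝ (Fin N → ℝ)) :
    laurentSum ω = ω.sum fun m w => evenMonomial m * logForm w := rfl

theorem laurentSum_single (m : Fin N → ℤ) (w : ExteriorAlgebra ℝ (Fin N → ℝ)) :
    laurentSum (Finsupp.single m w) = evenMonomial m * logForm w := by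
  simp [laurentSum]

theorem mul_mem_range_laurentSum {f g : Fun N} (hf : f ∈ LinearMap.range (laurentSum (N := N)))
    (hg : g ∈ LinearMap.range (laurentSum (N := N))) :
    f * g ∈ LinearMap.range (laurentSum (N := N)) := by
  obtain ⟨ω, rfl⟩ := hf
  obtain ⟨η, rfl⟩ := hg
  rw [laurentSum_apply, laurentSum_apply, Finsupp.sum, Finsupp.sum, Finset.sum_mul_sum]
  refine sum_mem fun m _ => sum_mem fun m' _ => ⟨Finsupp.single (m + m') (ω m * η m'), ?_⟩
  rw [laurentSum_single, map_mul, ← evenMonomial_mul,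
    (commute_evenMonomial_logForm m' (ω m)).symm.mul_mul_mul_comm]

theorem evenMonomial_mem_range_laurentSum (m : Fin N → ℤ) :
    evenMonomial m ∈ LinearMap.range (laurentSum (N := N)) :=
  ⟨Finsupp.single m 1, by rw [laurentSum_single, map_one, mul_one]⟩

theorem oddCoord_eq (i : Fin N) : oddCoord i = evenMonomial (Pi.single i 1) * logCoord i := by
  rw [logCoord, ← mul_assoc, evenMonomial_mul, ← Pi.single_add]
  simp [evenMonomial_zero]

/-- The range is closed under products, so it suffices to reach the `a^m` and `da_i = a_i dlog a_i`.
-/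
theorem laurentSum_surjective : Function.Surjective (laurentSum (N := N)) := by
  intro f
  have h1 : ∀ p : AddMonoidAlgebra ℝ (Fin N → ℤ),
      evenIncl p ∈ LinearMap.range (laurentSum (N := N)) := by
    intro p
    induction p using AddMonoidAlgebra.induction_on with
    | of m => exact evenMonomial_mem_range_laurentSum _
    | add a b ha hb => rw [map_add]; exact add_mem ha hb
    | smul r a ha => rw [map_smul]; exact Submodule.smul_mem _ _ ha
  have h2 : ∀ w : ExteriorAlgebra ℝ (Fin N → ℝ),
      oddIncl w ∈ LinearMap.range (laurentSum (N := N)) := by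
    intro w
    induction w using ExteriorAlgebra.induction with
    | algebraMap r =>
      rw [AlgHom.commutes, Algebra.algebraMap_eq_smul_one, ← evenMonomial_zero]
      exact Submodule.smul_mem _ _ (evenMonomial_mem_range_laurentSum _)
    | ι v =>
      rw [pi_eq_sum_univ' v, map_sum, map_sum]
      refine sum_mem fun i _ => ?_
      rw [map_smul, map_smul]
      refine Submodule.smul_mem _ _ ⟨Finsupp.single (Pi.single i 1)
        (ExteriorAlgebra.ι ℝ (Pi.single i 1)), ?_⟩
      rw [laurentSum_single, logForm_ι_single, one_smul, ← oddCoord_eq, oddCoord]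
    | mul a b ha hb => rw [map_mul]; exact mul_mem_range_laurentSum ha hb
    | add a b ha hb => rw [map_add]; exact add_mem ha hb
  change AddMonoidAlgebra ℝ (Fin N → ℤ) ⊗[ℝ] ExteriorAlgebra ℝ (Fin N → ℝ) at f
  change f ∈ LinearMap.range (laurentSum (N := N))
  induction f using TensorProduct.induction_on with
  | zero => exact zero_mem _
  | add a b ha hb => exact add_mem ha hb
  | tmul p w =>
    have e : (p ⊗ₜ[ℝ] w : AddMonoidAlgebra ℝ (Fin N → ℤ) ⊗[ℝ] ExteriorAlgebra ℝ (Fin N → ℝ)) =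
        (p ⊗ₜ[ℝ] 1) * ((1 : AddMonoidAlgebra ℝ (Fin N → ℤ)) ⊗ₜ[ℝ] w) := by
      rw [Algebra.TensorProduct.tmul_mul_tmul, mul_one, one_mul]
    rw [e]
    exact mul_mem_range_laurentSum (h1 p) (h2 w)

end LogForms

/-! ### Generating closed forms from odd traces and odd determinants. -/

section Differentials

variable {N : ℕ} {ε : ℤˣ}

/-- The exponent vector `m`, as a vector of real numbers. -/
def realVec : (Fin N → ℤ) →+ (Fin N → ℝ) := (Int.castAddHom ℝ).compLeft (Fin N)

theorem realVec_single (i : Fin N) (k : ℤ) : realVec (Pi.single i k) = Pi.single i (k : ℝ) := by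
  ext j
  by_cases h : j = i
  · subst h; simp [realVec]
  · simp [realVec, h]

/-- The differential `d(a^m) = a^m ∑ i, m_i dlog a_i`. -/
def dMonomial (m : Fin N → ℤ) : Fun N :=
  evenMonomial m * logForm (ExteriorAlgebra.ι ℝ (realVec m))

theorem dMonomial_single (i : Fin N) (k : ℤ) :
    dMonomial (Pi.single i k) = (k : ℝ) • (evenMonomial (Pi.single i k) * logCoord i) := by
  rw [dMonomial, realVec_single, logForm_ι_single, mul_smul_comm]

theorem dMonomial_comm (m : Fin N → ℤ) (m' : Fin N → ℤ) :
    dMonomial m * evenMonomial m' = evenMonomial m' * dMonomial m := by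
  rw [dMonomial, mul_assoc, ← (commute_evenMonomial_logForm m' _).eq, ← mul_assoc, ← mul_assoc,
    evenMonomial_mul, evenMonomial_mul, add_comm]

theorem dMonomial_add (m m' : Fin N → ℤ) :
    dMonomial (m + m') = evenMonomial m * dMonomial m' + evenMonomial m' * dMonomial m := by
  rw [dMonomial, dMonomial, dMonomial, ← mul_assoc, ← mul_assoc, evenMonomial_mul,
    evenMonomial_mul, add_comm m' m, map_add, map_add, map_add, mul_add, add_comm]

theorem dMonomial_mul_swap (m m' : Fin N → ℤ) :
    dMonomial m * dMonomial m' + dMonomial m' * dMonomial m = 0 := by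
  have e : ∀ m m' : Fin N → ℤ, dMonomial m * dMonomial m' = evenMonomial (m + m') *
      logForm (ExteriorAlgebra.ι ℝ (realVec m) * ExteriorAlgebra.ι ℝ (realVec m')) := by
    intro m m'
    rw [dMonomial, dMonomial, (commute_evenMonomial_logForm m' _).symm.mul_mul_mul_comm,
      evenMonomial_mul, map_mul]
  rw [e, e, add_comm m' m, ← mul_add, ← map_add, ExteriorAlgebra.ι_add_mul_swap, map_zero,
    mul_zero]

/-- The matrix `a^m + ξ d(a^m)`. -/
def monomialMat (ε : ℤˣ) (m : Fin N → ℤ) : QMat ε (Fun N) := ⟨evenMonomial m, dMonomial m⟩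

/-- The matrices `a^m + ξ d(a^m)` are multiplicative for the Jordan product. -/
theorem monomialMat_jordan (m m' : Fin N → ℤ) :
    monomialMat ε m * monomialMat ε m' + monomialMat ε m' * monomialMat ε m =
      monomialMat ε (m + m') + monomialMat ε (m + m') := by
  ext
  -- Differentials anticommute, so symmetrising cancels the `ε` term; the odd part below is the
  -- Leibniz rule, counted twice.
  · simp only [monomialMat, QMat.re_add, QMat.re_mul]
    rw [add_add_add_comm, ← mul_add, dMonomial_mul_swap, mul_zero, add_zero, evenMonomial_mul,
      evenMonomial_mul, add_comm m' m]
  · simp only [monomialMat, QMat.im_add, QMat.im_mul, dMonomial_add, dMonomial_comm]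
    abel

theorem coordMat_val (i : Fin N) :
    (coordMat ε i).val = monomialMat ε (Pi.single i 1) := by
  ext
  · rfl
  · simp [monomialMat, coordMat, dMonomial_single, oddCoord_eq i]

theorem coordMat_inv_val (i : Fin N) :
    (coordMat ε i)⁻¹.val = monomialMat ε (Pi.single i (-1)) := by
  ext
  · rfl
  · simp only [monomialMat, dMonomial_single, logCoord, ← mul_assoc, evenMonomial_mul,
      ← Pi.single_add]
    change -(evenMonomial (Pi.single i (-2)) * oddCoord i) = _
    simp

/-- `a^m + ξ d(a^m)` lies in the span of the words in the coordinate matrices, in the sense that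
the odd traces of its products with words are in the algebra of odd traces and determinants. -/
theorem otr_word_mul_monomialMat_mul_word_mem (m : Fin N → ℤ) (w w' : FreeGroup (Fin N)) :
    QMat.otr ((FreeGroup.lift (coordMat ε) w).val * monomialMat ε m *
      (FreeGroup.lift (coordMat ε) w').val) ∈
        Algebra.adjoin ℝ (oddTraces N ε ∪ oddDets N ε) := by
  let S := Algebra.adjoin ℝ (oddTraces N ε ∪ oddDets N ε)
  let W : FreeGroup (Fin N) → QMat ε (Fun N) := fun w => (FreeGroup.lift (coordMat ε) w).val
  -- Words on both sides make the induction close: the Jordan identity puts a factor `monomialMat ε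
  -- k` on the left or right of `monomialMat ε m`, and the adjacent word absorbs it.
  let good : (Fin N → ℤ) → Prop := fun m => ∀ w w', (W w * monomialMat ε m * W w').im ∈ S
  have step : ∀ (k : Fin N → ℤ) (u : FreeGroup (Fin N)), W u = monomialMat ε k →
      ∀ m, good m → good (m + k) := by
    intro k u hu m hm w w'
    have h1 : (2 : ℝ) • (W w * monomialMat ε (m + k) * W w').im =
        (W w * monomialMat ε m * W (u * w')).im + (W (w * u) * monomialMat ε m * W w').im := by
      have h2 : W (u * w') = monomialMat ε k * W w' := by rw [← hu]; simp [W]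
      have h3 : W (w * u) = W w * monomialMat ε k := by rw [← hu]; simp [W]
      rw [two_smul, ← QMat.im_add, ← QMat.im_add, ← add_mul, ← mul_add, ← monomialMat_jordan, h2,
        h3]
      congr 1
      noncomm_ring
    have h4 := S.smul_mem (add_mem (hm w (u * w')) (hm (w * u) w')) (2⁻¹ : ℝ)
    rwa [← h1, smul_smul, inv_mul_cancel₀ two_ne_zero, one_smul] at h4
  have step_single : ∀ (i : Fin N) m, good m ↔ good (m + Pi.single i 1) := by
    refine fun i m => ⟨step _ (FreeGroup.of i) (by simp [W, coordMat_val]) m, fun h => ?_⟩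
    have h1 := step (Pi.single i (-1)) (FreeGroup.of i)⁻¹
      (by simp only [W, map_inv, FreeGroup.lift_apply_of, coordMat_inv_val]) _ h
    rwa [add_assoc, ← Pi.single_add, add_neg_cancel, Pi.single_zero, add_zero] at h1
  -- The shifts preserving `good` in both directions form a group, so the unit vectors suffice even
  -- for negative exponents.
  let H : AddSubgroup (Fin N → ℤ) :=
    { carrier := {k | ∀ m, good m ↔ good (m + k)}
      zero_mem' := fun m => by rw [add_zero]
      add_mem' := fun {k k'} hk hk' m => by rw [hk m, hk' (m + k), add_assoc]
      neg_mem' := fun {k} hk m => by rw [hk (m + -k), neg_add_cancel_right] }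
  have hH : m ∈ H := by
    rw [← Finset.univ_sum_single m]
    refine sum_mem fun i _ => ?_
    have e : (Pi.single i (m i) : Fin N → ℤ) = m i • Pi.single i 1 := by
      rw [← Pi.single_smul, smul_eq_mul, mul_one]
    rw [e]
    exact zsmul_mem (show Pi.single i 1 ∈ H from step_single i) _
  have h0 : good 0 := by
    intro w w'
    have e : monomialMat ε (0 : Fin N → ℤ) = 1 := by
      ext
      · exact evenMonomial_zero
      · simp [monomialMat, dMonomial]
    rw [e, mul_one]
    refine Algebra.subset_adjoin (Or.inl ⟨w * w', ?_⟩)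
    simp [W, QMat.otr]
  have := (hH 0).mp h0
  rw [zero_add] at this
  exact this w w'

theorem dMonomial_mem_adjoin (m : Fin N → ℤ) :
    dMonomial m ∈ Algebra.adjoin ℝ (oddTraces N ε ∪ oddDets N ε) := by
  have h := otr_word_mul_monomialMat_mul_word_mem (ε := ε) m 1 1
  rwa [map_one, Units.val_one, one_mul, mul_one] at h

/-- The generators `dlog a_i` are exactly the odd determinants. -/
theorem logForm_mem_adjoin (w : ExteriorAlgebra ℝ (Fin N → ℝ)) :
    logForm w ∈ Algebra.adjoin ℝ (oddTraces N ε ∪ oddDets N ε) := by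
  induction w using ExteriorAlgebra.induction with
  | algebraMap r => rw [AlgHom.commutes]; exact Subalgebra.algebraMap_mem _ r
  | ι v =>
    rw [logForm_ι, Fintype.linearCombination_apply]
    refine sum_mem fun i _ => Subalgebra.smul_mem _ ?_ _
    exact Algebra.subset_adjoin (Or.inr ⟨i, odet_coordMat i⟩)
  | mul a b ha hb => rw [map_mul]; exact mul_mem ha hb
  | add a b ha hb => rw [map_add]; exact add_mem ha hb

/-- Exactness of the Koszul complex of a non-zero vector. -/
theorem exists_eq_ι_mul {V : Type*} [AddCommGroup V] [Module ℝ V] {v : V} (hv : v ≠ 0)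
    {w : ExteriorAlgebra ℝ V} (hw : ExteriorAlgebra.ι ℝ v * w = 0) :
    ∃ w', w = ExteriorAlgebra.ι ℝ v * w' := by
  obtain ⟨φ, hφ⟩ : ∃ φ : Module.Dual ℝ V, φ v = 1 := by
    obtain ⟨φ, hφ⟩ := not_forall.mp (mt (Module.forall_dual_apply_eq_zero_iff ℝ v).mp hv)
    exact ⟨(φ v)⁻¹ • φ, by simp [hφ]⟩
  -- Contraction with `φ` is a contracting homotopy for multiplication by `v`, since `φ v = 1`.
  refine ⟨CliffordAlgebra.contractLeft φ w, ?_⟩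
  have h := CliffordAlgebra.contractLeft_ι_mul φ v w
  rw [hw, map_zero, hφ, one_smul] at h
  exact (sub_eq_zero.mp h.symm)

/-- For `m = 0` the term is a polynomial in odd determinants; for `m ≠ 0` closedness lets one split
off `dlog(a^m)`, which `a^m` turns into `d(a^m)`. -/
theorem evenMonomial_mul_logForm_mem_adjoin (m : Fin N → ℤ) (w : ExteriorAlgebra ℝ (Fin N → ℝ))
    (hw : ExteriorAlgebra.ι ℝ (realVec m) * w = 0) :
    evenMonomial m * logForm w ∈ Algebra.adjoin ℝ (oddTraces N ε ∪ oddDets N ε) := by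
  by_cases hm : m = 0
  · rw [hm, evenMonomial_zero, one_mul]
    exact logForm_mem_adjoin w
  · have hv : realVec m ≠ 0 := fun h => hm <| funext fun i => by
      simpa [realVec] using congrFun h i
    obtain ⟨w', rfl⟩ := exists_eq_ι_mul hv hw
    rw [map_mul, ← mul_assoc]
    exact mul_mem (dMonomial_mem_adjoin m) (logForm_mem_adjoin w')

end Differentials

/-! ### Invariant functions are closed: test points over an exterior algebra. -/

section ExteriorPoints

open CliffordAlgebra (evenOdd)

/-- For the zero form all vectors are orthogonal, so the commutation rules for orthogonal isometries
apply with both isometries the identity. -/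
theorem evenOdd_zero_isSupercommutative {V : Type*} [AddCommGroup V] [Module ℝ V] :
    IsSupercommutative (evenOdd (0 : QuadraticForm ℝ V)) := by
  have hort : ∀ x y : V, QuadraticMap.IsOrtho (0 : QuadraticForm ℝ V)
      (QuadraticMap.Isometry.id (0 : QuadraticForm ℝ V) x)
      (QuadraticMap.Isometry.id (0 : QuadraticForm ℝ V) y) := fun x y => by
    simp [QuadraticMap.isOrtho_def]
  refine ⟨fun x hx y => ?_, fun x hx y hy => ?_⟩
  · induction y using DirectSum.Decomposition.inductionOn (evenOdd (0 : QuadraticForm ℝ V)) with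
    | zero => simp
    | homogeneous y =>
      have h := CliffordAlgebra.commute_map_mul_map_of_isOrtho_of_mem_evenOdd_zero_left
        _ _ hort x y.1 hx y.2
      simpa [CliffordAlgebra.map_id] using h.eq
    | add a b ha hb => rw [mul_add, add_mul, ha, hb]
  · have h := CliffordAlgebra.map_mul_map_eq_neg_of_isOrtho_of_mem_evenOdd_one _ _ hort x y hx hy
    simpa [CliffordAlgebra.map_id] using h

/-- Contraction with the last coordinate kills forms pulled in from `V`, so it strips the last
generator; projecting back to `V` then recovers `w`. -/
theorem eq_zero_of_ι_inr_mul_map_inl_eq_zero {V : Type*} [AddCommGroup V] [Module ℝ V]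
    {w : ExteriorAlgebra ℝ V}
    (hw : ExteriorAlgebra.ι ℝ ((0, 1) : V × ℝ) *
      ExteriorAlgebra.map (LinearMap.inl ℝ V ℝ) w = 0) : w = 0 := by
  have h0 : CliffordAlgebra.contractLeft (LinearMap.snd ℝ V ℝ)
      (ExteriorAlgebra.map (LinearMap.inl ℝ V ℝ) w) = 0 := by
    clear hw
    induction w using CliffordAlgebra.left_induction with
    | algebraMap r => rw [AlgHom.commutes]; exact CliffordAlgebra.contractLeft_algebraMap _ _ _
    | add a b ha hb => rw [map_add, map_add, ha, hb, add_zero]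
    | ι_mul a v ha =>
      have e := CliffordAlgebra.contractLeft_ι_mul (Q := (0 : QuadraticForm ℝ (V × ℝ)))
        (LinearMap.snd ℝ V ℝ) (v, 0) (ExteriorAlgebra.map (LinearMap.inl ℝ V ℝ) a)
      rw [ha, mul_zero, sub_zero, LinearMap.snd_apply, zero_smul] at e
      rw [map_mul]
      erw [ExteriorAlgebra.map_apply_ι]
      exact e
  have h1 := CliffordAlgebra.contractLeft_ι_mul (LinearMap.snd ℝ V ℝ) ((0, 1) : V × ℝ)
    (ExteriorAlgebra.map (LinearMap.inl ℝ V ℝ) w)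
  rw [hw, map_zero, h0, mul_zero, sub_zero, LinearMap.snd_apply, one_smul] at h1
  have h2 : (ExteriorAlgebra.map (LinearMap.fst ℝ V ℝ)).comp
      (ExteriorAlgebra.map (LinearMap.inl ℝ V ℝ)) = AlgHom.id ℝ _ := by
    rw [ExteriorAlgebra.map_comp_map, LinearMap.fst_comp_inl, ExteriorAlgebra.map_id]
  have h3 := DFunLike.congr_fun h2 w
  rw [AlgHom.comp_apply, ← h1, map_zero] at h3
  exact h3.symm

/-- Laurent monomials are linearly independent functions on the real torus, with coefficients in
any vector space. -/
theorem eq_zero_of_sum_zpow_smul_eq_zero {N : ℕ} {W : Type*} [AddCommGroup W] [Module ℝ W]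
    (s : Finset (Fin N → ℤ)) (z : (Fin N → ℤ) → W)
    (hz : ∀ t : Fin N → ℝˣ, ∑ m ∈ s, ((∏ i, t i ^ m i : ℝˣ) : ℝ) • z m = 0) :
    ∀ m ∈ s, z m = 0 := by
  intro m hm
  let χ : (Fin N → ℤ) → ((Fin N → ℝˣ) →* ℝ) := fun m =>
    (Units.coeHom ℝ).comp
      { toFun := fun t => ∏ i, t i ^ m i
        map_one' := by simp
        map_mul' := fun t t' => by simp [mul_zpow, Finset.prod_mul_distrib] }
  have hχ : ∀ m t, χ m t = ((∏ i, t i ^ m i : ℝˣ) : ℝ) := fun m t => rfl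
  have hinj : Function.Injective χ := by
    intro m m' h
    funext i
    -- The torus point with `i`-th coordinate 2 and all others 1 detects `m i`, as powers of 2 are
    -- distinct.
    have h1 := DFunLike.congr_fun h (Pi.mulSingle i (Units.mk0 2 two_ne_zero))
    have h2 : ∀ m, χ m (Pi.mulSingle i (Units.mk0 2 two_ne_zero)) = (2 : ℝ) ^ m i := by
      intro m
      rw [hχ, Finset.prod_eq_single i]
      · simp
      · intro j _ hj
        simp [Pi.mulSingle_eq_of_ne hj]
      · simp
    rw [h2, h2] at h1
    exact zpow_right_injective₀ (by norm_num) (by norm_num) h1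
  have hli : LinearIndependent ℝ fun m => (χ m : (Fin N → ℝˣ) → ℝ) :=
    (linearIndependent_monoidHom (Fin N → ℝˣ) ℝ).comp χ hinj
  -- Linear functionals reduce vector coefficients to scalars, where independence of characters
  -- applies.
  refine (Module.forall_dual_apply_eq_zero_iff ℝ (z m)).mp fun φ => ?_
  refine linearIndependent_iff'.mp hli s (fun m => φ (z m)) ?_ m hm
  funext t
  have h := congrArg φ (hz t)
  rw [map_sum, map_zero] at h
  rw [Finset.sum_apply, Pi.zero_apply, ← h]
  refine Finset.sum_congr rfl fun m _ => ?_
  rw [map_smul, Pi.smul_apply, hχ, smul_eq_mul, smul_eq_mul, mul_comm]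

variable {N : ℕ}

/-- The exterior algebra on `N + 1` generators. -/
abbrev Ext (N : ℕ) : Type := ExteriorAlgebra ℝ ((Fin N → ℝ) × ℝ)

/-- The grading by parity on the exterior algebra on `N + 1` generators. -/
abbrev extParity (N : ℕ) : ZMod 2 → Submodule ℝ (Ext N) :=
  evenOdd (0 : QuadraticForm ℝ ((Fin N → ℝ) × ℝ))

/-- The inclusion of the exterior algebra on the first `N` generators. -/
def extIncl : ExteriorAlgebra ℝ (Fin N → ℝ) →ₐ[ℝ] Ext N :=
  ExteriorAlgebra.map (LinearMap.inl ℝ (Fin N → ℝ) ℝ)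

/-- A linear form in the first `N` generators. -/
def extVec (v : Fin N → ℝ) : Ext N := ExteriorAlgebra.ι ℝ (v, 0)

/-- The last generator. -/
def extLast (N : ℕ) : Ext N := ExteriorAlgebra.ι ℝ (0, 1)

theorem extIncl_ι (v : Fin N → ℝ) : extIncl (ExteriorAlgebra.ι ℝ v) = extVec v := by
  simp [extIncl, extVec]

theorem extVec_mem (v : Fin N → ℝ) : extVec v ∈ extParity N 1 :=
  CliffordAlgebra.ι_mem_evenOdd_one _ _

theorem extLast_mem : extLast N ∈ extParity N 1 := CliffordAlgebra.ι_mem_evenOdd_one _ _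

theorem extSuper : IsSupercommutative (extParity N) := evenOdd_zero_isSupercommutative

/-- The element `1 + ξ η` of `Q(1)`, for the last generator `η`. -/
def extConj (ε : ℤˣ) (N : ℕ) : Q1 ε (extParity N) where
  val := ⟨⟨1, extLast N⟩, SetLike.GradedOne.one_mem, extLast_mem⟩
  inv := ⟨⟨1, -extLast N⟩, SetLike.GradedOne.one_mem, neg_mem extLast_mem⟩
  val_inv := by
    refine Subtype.ext (QMat.ext ?_ ?_) <;> simp [extSuper.odd_sq extLast_mem]
  inv_val := by
    refine Subtype.ext (QMat.ext ?_ ?_) <;> simp [extSuper.odd_sq extLast_mem]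

/-- The point `(t_i + ξ t_i e_i)_i` of `Q(1)^N`, for the first `N` generators `e_i`. -/
def extPoint (ε : ℤˣ) (t : Fin N → ℝˣ) (i : Fin N) : Q1 ε (extParity N) where
  val := ⟨⟨algebraMap ℝ _ (t i), (t i : ℝ) • extVec (Pi.single i 1)⟩,
    SetLike.algebraMap_mem_graded _ _, Submodule.smul_mem _ _ (extVec_mem _)⟩
  inv := ⟨⟨algebraMap ℝ _ ((t i)⁻¹ : ℝˣ), (-((t i)⁻¹ : ℝˣ) : ℝ) • extVec (Pi.single i 1)⟩,
    SetLike.algebraMap_mem_graded _ _, Submodule.smul_mem _ _ (extVec_mem _)⟩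
  val_inv := by
    refine Subtype.ext (QMat.ext ?_ ?_)
    · simp [extSuper.odd_sq (extVec_mem _), ← map_mul]
    · simp [← Algebra.smul_def, ← Algebra.commutes, smul_smul]
  inv_val := by
    refine Subtype.ext (QMat.ext ?_ ?_)
    · simp [extSuper.odd_sq (extVec_mem _), ← map_mul]
    · simp [← Algebra.smul_def, ← Algebra.commutes, smul_smul]

/-- The factor `t_i` in the odd coordinate makes `dlog a_i` evaluate to `e_i` for all `t`, so `t`
enters only through Laurent monomials. -/
theorem evalAt_extPoint_logForm (ε : ℤˣ) (t : Fin N → ℝˣ) (w : ExteriorAlgebra ℝ (Fin N → ℝ)) :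
    evalAt extSuper (extPoint ε t) (logForm w) = extIncl w := by
  have h : (evalAt extSuper (extPoint ε t)).comp logForm = extIncl := by
    refine ExteriorAlgebra.hom_ext (LinearMap.pi_ext' fun i => LinearMap.ext_ring ?_)
    simp only [LinearMap.comp_apply, AlgHom.toLinearMap_apply, AlgHom.comp_apply,
      LinearMap.single_apply, logForm_ι_single, one_smul, extIncl_ι, logCoord, map_mul,
      evalAt_evenMonomial_single, evalAt_oddCoord]
    have h1 : (extPoint ε t i).1.1.im = (extPoint ε t i).1.1.re * extVec (Pi.single i 1) :=
      Algebra.smul_def _ _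
    rw [h1, ← extSuper.coe_reUnit, ← mul_assoc, ← MulMemClass.coe_mul]
    simp
  exact DFunLike.congr_fun h w

theorem evalAt_conj_logForm {Λ : Type*} [Ring Λ] [Algebra ℝ Λ] {ε : ℤˣ}
    {𝒜 : ZMod 2 → Submodule ℝ Λ} [GradedAlgebra 𝒜] (h : IsSupercommutative 𝒜) (g : Q1 ε 𝒜)
    (A : Fin N → Q1 ε 𝒜) (w : ExteriorAlgebra ℝ (Fin N → ℝ)) :
    evalAt h (fun i => g * A i * g⁻¹) (logForm w) = evalAt h A (logForm w) := by
  have h : (evalAt h (fun i => g * A i * g⁻¹)).comp logForm = (evalAt h A).comp logForm := by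
    refine ExteriorAlgebra.hom_ext (LinearMap.pi_ext' fun i => LinearMap.ext_ring ?_)
    simp only [LinearMap.comp_apply, AlgHom.toLinearMap_apply, AlgHom.comp_apply,
      LinearMap.single_apply, logForm_ι_single, one_smul, evalAt_logCoord_conj]
  exact DFunLike.congr_fun h w

theorem extLast_mul_extVec_mul (v v' : Fin N → ℝ) :
    extLast N * extVec v * (extLast N * extVec v') = 0 := by
  rw [mul_assoc, ← mul_assoc (extVec v), ← mul_assoc,
    extSuper.mul_mul_self_of_odd extLast_mem (extVec_mem v), zero_mul]

theorem one_add_extLast_mul_extVec_mem_center (c : ℝ) (v : Fin N → ℝ) :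
    1 + c • (extLast N * extVec v) ∈ Subalgebra.center ℝ (Ext N) := by
  have h : extLast N * extVec v ∈ extParity N 0 :=
    mul_mem_even_of_odd extLast_mem (extVec_mem v)
  refine add_mem (one_mem _) (Subalgebra.smul_mem _ ?_ c)
  exact Subalgebra.mem_center_iff.mpr fun y => (extSuper.even_comm _ h y).symm

/-- The cross term contains the last generator twice. -/
theorem one_add_extLast_mul_extVec_add (c : ℝ) (v v' : Fin N → ℝ) :
    1 + c • (extLast N * extVec (v + v')) =
      (1 + c • (extLast N * extVec v)) * (1 + c • (extLast N * extVec v')) := by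
  have e : extVec (v + v') = extVec v + extVec v' := by
    rw [extVec, extVec, extVec, ← map_add, Prod.mk_add_mk, add_zero]
  rw [add_mul, one_mul, mul_add, mul_one, smul_mul_smul_comm, extLast_mul_extVec_mul, smul_zero,
    e, mul_add, smul_add]
  abel

/-- The homomorphism `v ↦ 1 + c η v` to the centre, for the last generator `η`. -/
def extShearHom (c : ℝ) (N : ℕ) :
    Multiplicative (Fin N → ℝ) →* Subalgebra.center ℝ (Ext N) where
  toFun v := ⟨1 + c • (extLast N * extVec v.toAdd), one_add_extLast_mul_extVec_mem_center c _⟩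
  map_one' := Subtype.ext <| by
    have e : extVec (0 : Fin N → ℝ) = 0 := by rw [extVec, Prod.mk_zero_zero, map_zero]
    change 1 + c • (extLast N * extVec (0 : Fin N → ℝ)) = 1
    rw [e, mul_zero, smul_zero, add_zero]
  map_mul' v v' := Subtype.ext (one_add_extLast_mul_extVec_add c _ _)

/-- The homomorphism `v ↦ 1 + 2 ε η v` to the units of the centre, for the last generator `η`. -/
def extShear (ε : ℤˣ) (N : ℕ) :
    Multiplicative (Fin N → ℝ) →* (Subalgebra.center ℝ (Ext N))ˣ :=
  (extShearHom (2 * ((ε : ℤ) : ℝ)) N).toHomUnits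

theorem reUnit_extPoint (ε : ℤˣ) (t : Fin N → ℝˣ) (i : Fin N) :
    extSuper.reUnit (extPoint ε t i) =
      Units.map (algebraMap ℝ (Subalgebra.center ℝ (Ext N))).toMonoidHom (t i) :=
  Units.ext (Subtype.ext rfl)

/-- Conjugating `x + ξ y` by `1 + ξ η` adds `ε (η y - y η) = 2 ε η y` to `x`; here `y = t_i e_i`, so
`t_i` factors out. -/
theorem reUnit_extPoint_conj (ε : ℤˣ) (t : Fin N → ℝˣ) (i : Fin N) :
    extSuper.reUnit (extConj ε N * extPoint ε t i * (extConj ε N)⁻¹) =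
      Units.map (algebraMap ℝ (Subalgebra.center ℝ (Ext N))).toMonoidHom (t i) *
        extShear ε N (Multiplicative.ofAdd (Pi.single i 1)) := by
  refine Units.ext (Subtype.ext ?_)
  change (1 * algebraMap ℝ _ (t i : ℝ) + ((ε : ℤ) : Ext N) *
    (extLast N * ((t i : ℝ) • extVec (Pi.single i 1)))) * 1 + ((ε : ℤ) : Ext N) *
      ((1 * ((t i : ℝ) • extVec (Pi.single i 1)) + extLast N * algebraMap ℝ _ (t i : ℝ)) *
        -extLast N) = algebraMap ℝ _ (t i : ℝ) *
          (1 + (2 * ((ε : ℤ) : ℝ)) • (extLast N * extVec (Pi.single i 1)))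
  have h1 := extSuper.odd_anticomm _ (extVec_mem (Pi.single i 1)) _ (extLast_mem (N := N))
  have h2 := extSuper.odd_sq (extLast_mem (N := N))
  simp only [Algebra.algebraMap_eq_smul_one, one_mul, mul_one, mul_neg, add_mul, smul_mul_assoc,
    mul_smul_comm, h1, h2, smul_zero, add_zero, smul_neg, neg_neg]
  obtain rfl | rfl := Int.units_eq_one_or ε
  · simp only [Units.val_one, Int.cast_one, one_mul, mul_one]
    module
  · simp only [Units.val_neg, Units.val_one, Int.cast_neg, Int.cast_one, neg_mul, one_mul, mul_neg,
      mul_one]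
    module

theorem evalAt_extPoint_evenMonomial (ε : ℤˣ) (t : Fin N → ℝˣ) (m : Fin N → ℤ) :
    evalAt extSuper (extPoint ε t) (evenMonomial m) =
      algebraMap ℝ _ ((∏ i, t i ^ m i : ℝˣ) : ℝ) := by
  simp only [evalAt_evenMonomial, reUnit_extPoint, ← map_zpow, ← map_prod]
  rfl

theorem evalAt_extPoint_conj_evenMonomial (ε : ℤˣ) (t : Fin N → ℝˣ) (m : Fin N → ℤ) :
    evalAt extSuper (fun i => extConj ε N * extPoint ε t i * (extConj ε N)⁻¹) (evenMonomial m) =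
      algebraMap ℝ _ ((∏ i, t i ^ m i : ℝˣ) : ℝ) *
        (1 + (2 * ((ε : ℤ) : ℝ)) • (extLast N * extVec (realVec m))) := by
  have e : ∏ i, Multiplicative.ofAdd (Pi.single i 1 : Fin N → ℝ) ^ m i =
      Multiplicative.ofAdd (realVec m) := by
    simp only [← ofAdd_zsmul, ← ofAdd_sum]
    congr 1
    rw [← Finset.univ_sum_single (realVec m)]
    refine Finset.sum_congr rfl fun i _ => ?_
    rw [← Pi.single_smul]
    simp [realVec]
  simp only [evalAt_evenMonomial, reUnit_extPoint_conj, mul_zpow, Finset.prod_mul_distrib,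
    ← map_zpow, ← map_prod, e]
  rfl

/-- The values at a test point and at its conjugate differ by `2 ε ∑ t^m η dlog(a^m) ω_m`. Varying
`t` separates the exponents, and `η` is then cancelled. -/
theorem ι_realVec_mul_eq_zero_of_isConjInvariant {ε : ℤˣ}
    {ω : (Fin N → ℤ) →₀ ExteriorAlgebra ℝ (Fin N → ℝ)} (hω : IsConjInvariant ε (laurentSum ω))
    (m : Fin N → ℤ) (hm : m ∈ ω.support) : ExteriorAlgebra.ι ℝ (realVec m) * ω m = 0 := by
  refine eq_zero_of_ι_inr_mul_map_inl_eq_zero ?_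
  refine eq_zero_of_sum_zpow_smul_eq_zero ω.support
    (fun m => extLast N * extIncl (ExteriorAlgebra.ι ℝ (realVec m) * ω m)) (fun t => ?_) m hm
  have h := hω (Ext N) (extParity N) extSuper (extConj ε N) (extPoint ε t)
  simp only [laurentSum_apply, Finsupp.sum, map_sum, map_mul, evalAt_conj_logForm,
    evalAt_extPoint_logForm, evalAt_extPoint_conj_evenMonomial, evalAt_extPoint_evenMonomial] at h
  rw [← sub_eq_zero, ← Finset.sum_sub_distrib] at h
  have h1 : (2 * ((ε : ℤ) : ℝ)) • ∑ m ∈ ω.support, ((∏ i, t i ^ m i : ℝˣ) : ℝ) •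
      (extLast N * extIncl (ExteriorAlgebra.ι ℝ (realVec m) * ω m)) = 0 := by
    rw [← h, Finset.smul_sum]
    refine Finset.sum_congr rfl fun m _ => ?_
    rw [mul_add, mul_one, add_mul, add_sub_cancel_left, map_mul, extIncl_ι, ← Algebra.smul_def,
      smul_mul_assoc, smul_mul_assoc, smul_comm, mul_assoc]
  refine (smul_eq_zero.mp h1).resolve_left (mul_ne_zero two_ne_zero ?_)
  exact_mod_cast ε.ne_zero

end ExteriorPoints

end QueerOne
end

theorem mainTheorem7 (ε : ℤˣ) (N : ℕ) :
    (Algebra.adjoin ℝ (QueerOne.oddTraces N ε ∪ QueerOne.oddDets N ε) : Set (QueerOne.Fun N)) =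
      {f : QueerOne.Fun N | QueerOne.IsConjInvariant ε f} := by
  refine Set.Subset.antisymm (fun f hf => QueerOne.isConjInvariant_of_mem_adjoin hf) fun f hf => ?_
  obtain ⟨ω, rfl⟩ := QueerOne.laurentSum_surjective f
  rw [SetLike.mem_coe, QueerOne.laurentSum_apply]
  exact sum_mem fun m hm => QueerOne.evenMonomial_mul_logForm_mem_adjoin m (ω m)
    (QueerOne.ι_realVec_mul_eq_zero_of_isConjInvariant hf m hm)
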